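/- All rings are associative and unital, ideals are two-sided, and $R[G]$ denotes the group ring. A ring $S$ is *left (resp. right) pure semisimple* if every left (resp. right) $S$-module is a direct sum of finitely generated submodules, and *left (resp. right) Köthe* if every left (resp. right) $S$-module is a direct sum of cyclic submodules. Let $R$ be a nonzero ring and let $G$ be a group. The following two assertions hold. (a) If $R[G]$ is left (resp. right) pure semisimple, then for every proper ideal $I$ of $R$ and every normal subgroup $N$ of $G$ the ring $(R/I)[G/N]$ is left (resp. right) pure semisimple and left (resp. right) artinian. In particular, $R/I$ (for every proper ideal $I$ of $R$), $R$ and $R[G]$ are left (resp. right) pure semisimple and left (resp. right) artinian, and $G$ is finite. (b) If $R[G]$ is left (resp. right) Köthe, then for every proper ideal $I$ of $R$ and every normal subgroup $N$ of $G$ the ring $(R/I)[G/N]$ is left (resp. right) Köthe and left (resp. right) artinian. In particular, $R/I$ (for every proper ideal $I$ of $R$), $R$ and $R[G]$ are left (resp. right) Köthe and left (resp. right) artinian, and $G$ is finite. -/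

import Mathlib

universe u v w

/-- `S` is a left Köthe ring: every left `S`-module is the (internal) direct sum of a family of
cyclic submodules. The modules range over a universe at least as large as that of `S`. -/
def IsLeftKothe (S : Type u) [Ring S] : Prop :=
  ∀ (M : Type (max u w)) [AddCommGroup M] [Module S M],
    ∃ (ι : Type (max u w)) (_ : DecidableEq ι) (N : ι → Submodule S M),
      DirectSum.IsInternal N ∧ ∀ i, (N i).IsPrincipal

/-- `S` is a left pure semisimple ring: every left `S`-module is the (internal) direct sum of a
family of finitely generated submodules. -/
def IsLeftPureSemisimple (S : Type u) [Ring S] : Prop :=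
  ∀ (M : Type (max u w)) [AddCommGroup M] [Module S M],
    ∃ (ι : Type (max u w)) (_ : DecidableEq ι) (N : ι → Submodule S M),
      DirectSum.IsInternal N ∧ ∀ i, (N i).FG

/-- `S` is a right Köthe ring; right `S`-modules are modules over `Sᵐᵒᵖ`. -/
def IsRightKothe (S : Type u) [Ring S] : Prop :=
  ∀ (M : Type (max u w)) [AddCommGroup M] [Module Sᵐᵒᵖ M],
    ∃ (ι : Type (max u w)) (_ : DecidableEq ι) (N : ι → Submodule Sᵐᵒᵖ M),
      DirectSum.IsInternal N ∧ ∀ i, (N i).IsPrincipal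

/-- `S` is a right pure semisimple ring; right `S`-modules are modules over `Sᵐᵒᵖ`. -/
def IsRightPureSemisimple (S : Type u) [Ring S] : Prop :=
  ∀ (M : Type (max u w)) [AddCommGroup M] [Module Sᵐᵒᵖ M],
    ∃ (ι : Type (max u w)) (_ : DecidableEq ι) (N : ι → Submodule Sᵐᵒᵖ M),
      DirectSum.IsInternal N ∧ ∀ i, (N i).FG

/-- `S` is left artinian: the left ideals of `S` satisfy the descending chain condition. -/
abbrev IsLeftArtinian (S : Type u) [Ring S] : Prop := IsArtinianRing S

/-- `S` is right artinian: the right ideals of `S`, i.e. the `Sᵐᵒᵖ`-submodules of `S`, satisfy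
the descending chain condition. -/
abbrev IsRightArtinian (S : Type u) [Ring S] : Prop := IsArtinian Sᵐᵒᵖ S

/-! Both properties pass to homomorphic images, the Köthe property implies pure semisimplicity, and
every ring in question is an image of `R[G]` (`R` itself through the augmentation). Two facts
remain: a left pure semisimple ring is left artinian, and a group with an artinian group ring over a
nonzero ring is finite.

The first rests on Chase's argument. A descending chain of subfunctors commuting with products must
stall somewhere along any sequence of modules (`exists_obj_le`); otherwise, in a product of
sufficiently large powers, a finitely generated summand would have too many elements. Annihilators
of left ideals then give left noetherian; the functors `M ↦ p n • M` give the descending chain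
condition on principal right ideals. The latter makes `S ⧸ J` semisimple, for `J` the Jacobson
radical, and together with noetherianity makes `J` nilpotent; Hopkins–Levitzki concludes.

The second is Connell's theorem. Subgroups embed strictly monotonically into left ideals, so `G`
satisfies both chain conditions on subgroups and its FC-center `Δ` is finite. Over `R ⧸ J(R)` the
group ring of `G ⧸ Δ` is semiprime, because Neumann's lemma on coset coverings isolates one
coefficient of a product. Artinian and semiprime give semisimple, and a complement of the
augmentation ideal contains a nonzero `G`-invariant element, whose support is finite; so `G ⧸ Δ` is
finite. Right-hand statements come from opposite rings. -/

/-- Every left `S`-module in the universe `max u w` is an internal direct sum of submodules each of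
which is spanned by a set with fewer than `κ` elements. -/
def EveryModuleDecomposes (κ : ℕ∞) (S : Type u) [Ring S] : Prop :=
  ∀ (M : Type (max u w)) [AddCommGroup M] [Module S M],
    ∃ (ι : Type (max u w)) (_ : DecidableEq ι) (N : ι → Submodule S M),
      DirectSum.IsInternal N ∧ ∀ i, ∃ s : Set M, s.encard < κ ∧ Submodule.span S s = N i

/-- With the next lemma, this lets one parameter `κ` treat both properties: `⊤` for pure semisimple,
`2` for Köthe. -/
theorem Submodule.fg_iff_exists_encard_lt_top {S M : Type*} [Ring S] [AddCommGroup M] [Module S M]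
    (N : Submodule S M) : N.FG ↔ ∃ s : Set M, s.encard < ⊤ ∧ Submodule.span S s = N := by
  simp_rw [Submodule.fg_def, Set.encard_lt_top_iff]

theorem Submodule.isPrincipal_iff_exists_encard_lt_two {S M : Type*} [Ring S] [AddCommGroup M]
    [Module S M] (N : Submodule S M) :
    N.IsPrincipal ↔ ∃ s : Set M, s.encard < 2 ∧ Submodule.span S s = N := by
  constructor
  · rintro ⟨a, rfl⟩
    exact ⟨{a}, by simp, rfl⟩
  · rintro ⟨s, hs, rfl⟩
    have : s.encard ≤ 1 := Order.le_of_lt_add_one (by simpa [one_add_one_eq_two] using hs)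
    rcases Set.encard_le_one_iff_eq.1 this with rfl | ⟨a, rfl⟩
    · exact ⟨0, by simp⟩
    · exact ⟨a, rfl⟩

/-- The property passes to homomorphic images. The module universes of the two rings are only
required to coincide. -/
theorem EveryModuleDecomposes.of_surjective {κ : ℕ∞} {S : Type u} {T : Type v} [Ring S] [Ring T]
    (h : EveryModuleDecomposes.{u, max v w} κ S) (f : S →+* T) (hf : Function.Surjective f) :
    EveryModuleDecomposes.{v, max u w} κ T := by
  intro M _ _
  let : Module S M := Module.compHom M f
  obtain ⟨ι, hι, N, hN, hs⟩ := h M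
  -- Since `f` is onto, the two rings have the same submodules in `M`.
  let e : Submodule S M ≃o Submodule T M :=
    { toFun := fun N ↦ { N with
        smul_mem' := fun t x hx ↦ by
          obtain ⟨a, rfl⟩ := hf t
          exact N.smul_mem a hx }
      invFun := fun N ↦ { N with smul_mem' := fun a x hx ↦ N.smul_mem (f a) hx }
      left_inv := fun N ↦ rfl
      right_inv := fun N ↦ rfl
      map_rel_iff' := Iff.rfl }
  have span_eq (s : Set M) : Submodule.span T s = e (Submodule.span S s) := by
    apply le_antisymm
    · exact Submodule.span_le.2 (Submodule.subset_span (R := S))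
    · rw [← e.le_symm_apply]
      exact Submodule.span_le.2 (Submodule.subset_span (R := T))
  refine ⟨ι, hι, fun i ↦ e (N i), ?_, fun i ↦ ?_⟩
  · rw [DirectSum.isInternal_submodule_iff_iSupIndep_and_iSup_eq_top] at hN ⊢
    refine ⟨hN.1.map_orderIso e, ?_⟩
    rw [← e.map_iSup, hN.2, e.map_top]
  · obtain ⟨s, hs, hsN⟩ := hs i
    exact ⟨s, hs, by rw [span_eq, hsN]⟩

/-! ### Chase's argument on decompositions of products -/

theorem DirectSum.IsInternal.exists_projections {S M ι : Type*} [Ring S] [AddCommGroup M]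
    [Module S M] [DecidableEq ι] {N : ι → Submodule S M} (h : DirectSum.IsInternal N) :
    ∃ π : ι → M →ₗ[S] M, (∀ j x, π j x ∈ N j) ∧
      ∀ x, ∃ J : Finset ι, (∀ j ∉ J, π j x = 0) ∧ ∑ j ∈ J, π j x = x := by
  classical
  let e := LinearEquiv.ofBijective (DirectSum.coeLinearMap N) h
  refine ⟨fun j ↦ (N j).subtype ∘ₗ DirectSum.component S ι (fun i ↦ N i) j ∘ₗ e.symm.toLinearMap,
    fun j x ↦ (DirectSum.component S ι (fun i ↦ N i) j (e.symm x)).2, fun x ↦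
      ⟨DFinsupp.support (e.symm x), fun j hj ↦ ?_, ?_⟩⟩
  · have : (e.symm x) j = 0 := by simpa using hj
    change ((e.symm x) j : M) = 0
    rw [this, ZeroMemClass.coe_zero]
  · conv_rhs => rw [← e.apply_symm_apply x]
    change _ = DirectSum.coeLinearMap N (e.symm x)
    rw [DirectSum.coeLinearMap_eq_dfinsuppSum]
    rfl

/-- A descending sequence of additive subfunctors of the forgetful functor on left `S`-modules that
commute with countable products. -/
structure SubfunctorChain (S : Type u) [Ring S] where
  obj : ℕ → ∀ (M : Type (max u w)) [AddCommGroup M] [Module S M], AddSubgroup M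
  anti : ∀ (M : Type (max u w)) [AddCommGroup M] [Module S M], Antitone (obj · M)
  map_mem : ∀ {M M' : Type (max u w)} [AddCommGroup M] [Module S M] [AddCommGroup M'] [Module S M']
    (f : M →ₗ[S] M') {n : ℕ} {x : M}, x ∈ obj n M → f x ∈ obj n M'
  pi_mem : ∀ {A : ℕ → Type (max u w)} [∀ i, AddCommGroup (A i)] [∀ i, Module S (A i)] {n : ℕ}
    {x : ∀ i, A i}, (∀ i, x i ∈ obj n (A i)) → x ∈ obj n (∀ i, A i)

/-- Chase's lemma: if the product of the `A i` is a direct sum with projections `π j`, then for some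
`n` all but finitely many `π j` send `F n (A n)` into `F (n + 1)` of the product. -/
theorem SubfunctorChain.exists_forall_notMem {S : Type u} [Ring S] (F : SubfunctorChain.{u, w} S)
    (A : ℕ → Type (max u w)) [∀ i, AddCommGroup (A i)] [∀ i, Module S (A i)]
    {ι : Type*} (π : ι → (∀ i, A i) →ₗ[S] (∀ i, A i))
    (hπ : ∀ x, ∃ J : Finset ι, (∀ j ∉ J, π j x = 0)) :
    ∃ (n : ℕ) (J : Finset ι), ∀ x ∈ F.obj n (A n), ∀ j ∉ J,
      π j (Pi.single n x) ∈ F.obj (n + 1) (∀ i, A i) := by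
  classical
  by_contra! H
  choose supp hsupp using hπ
  choose y hy k hk hyk using H
  -- the recursion carries the partial sum and the finite set of indices already used
  let st : ℕ → (∀ i, A i) × Finset ι := fun n ↦ Nat.rec (0, ∅) (fun n p ↦
    let J := p.2 ∪ supp p.1
    (p.1 + Pi.single n (y n J), insert (k n J) p.2)) n
  let t : ℕ → ∀ i, A i := fun n ↦ (st n).1
  let U : ℕ → Finset ι := fun n ↦ (st n).2
  let J : ℕ → Finset ι := fun n ↦ U n ∪ supp (t n)
  let x : ∀ i, A i := fun i ↦ y i (J i)
  let j : ℕ → ι := fun n ↦ k n (J n)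
  have t_succ (n : ℕ) : t (n + 1) = t n + Pi.single n (x n) := rfl
  have U_succ (n : ℕ) : U (n + 1) = insert (j n) (U n) := rfl
  have t_apply (n i : ℕ) : t n i = if i < n then x i else 0 := by
    induction n with
    | zero => simp [t, st]
    | succ n ih =>
      rw [t_succ, Pi.add_apply, ih]
      rcases lt_trichotomy i n with h | rfl | h
      · rw [Pi.single_eq_of_ne h.ne, if_pos h, if_pos (by omega), add_zero]
      · simp
      · rw [Pi.single_eq_of_ne h.ne', if_neg (by omega), if_neg (by omega), add_zero]
  have used (m n : ℕ) (h : m < n) : j m ∈ U n := by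
    induction n with
    | zero => omega
    | succ n ih =>
      rw [U_succ]
      rcases Nat.lt_succ_iff_lt_or_eq.1 h with h | rfl
      · exact Finset.mem_insert_of_mem (ih h)
      · exact Finset.mem_insert_self _ _
  have hj (n : ℕ) : j n ∉ J n := hk n (J n)
  have j_inj : Function.Injective j := by
    intro m n hmn
    by_contra hne
    rcases Nat.lt_or_gt_of_ne hne with h | h
    · exact hj n (Finset.mem_union_left _ (hmn ▸ used m n h))
    · exact hj m (Finset.mem_union_left _ (hmn ▸ used n m h))
  -- Split `x` as `t n`, the `n`-th coordinate, and a tail in `F (n + 1)`. The projection `π (j n)`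
  -- kills the first, moves the second outside `F (n + 1)` and keeps the tail inside it.
  have ne_zero (n : ℕ) : π (j n) x ≠ 0 := by
    intro h0
    have h1 : π (j n) (t n) = 0 := hsupp _ _ fun h ↦ hj n (Finset.mem_union_right _ h)
    have h2 : x - t (n + 1) ∈ F.obj (n + 1) (∀ i, A i) := by
      refine F.pi_mem fun i ↦ ?_
      have hi := t_apply (n + 1) i
      split_ifs at hi with h
      · have : (x - t (n + 1)) i = 0 := sub_eq_zero.2 hi.symm
        exact this ▸ zero_mem _
      · have : (x - t (n + 1)) i = x i := sub_eq_self.2 hi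
        exact this ▸ F.anti _ (not_lt.1 h) (hy i (J i))
    have h3 := F.map_mem (π (j n)) h2
    rw [t_succ, map_sub, map_add, h0, h1, zero_add, zero_sub, neg_mem_iff] at h3
    exact hyk n (J n) h3
  refine Set.infinite_range_of_injective j_inj ((supp x).finite_toSet.subset ?_)
  rintro _ ⟨n, rfl⟩
  by_contra h
  exact ne_zero n (hsupp x _ h)

theorem Submodule.FG.mk_le {S : Type u} {M : Type v} [Ring S] [AddCommGroup M] [Module S M]
    {Q : Submodule S M} (hQ : Q.FG) :
    Cardinal.lift.{u} (Cardinal.mk Q) ≤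
      Cardinal.lift.{v} (max (Cardinal.mk S) Cardinal.aleph0) := by
  have := Module.Finite.iff_fg.2 hQ
  obtain ⟨n, f, hf⟩ := Module.Finite.exists_fin' S Q
  have h1 := Cardinal.mk_le_of_surjective
    (f := (ULift.up.{u} ∘ f ∘ ULift.down.{v} : ULift.{v} (Fin n → S) → ULift.{u} Q))
    (ULift.up_surjective.comp (hf.comp ULift.down_surjective))
  simp only [Cardinal.mk_uLift] at h1
  refine h1.trans (Cardinal.lift_le.2 ?_)
  simpa using Cardinal.power_nat_le_max (c := Cardinal.mk S) (n := n)

/-- If every module is a direct sum of finitely generated modules, then no chain of subfunctors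
descends strictly at every step along a sequence of modules. -/
theorem EveryModuleDecomposes.exists_obj_le {S : Type u} [Ring S]
    (h : EveryModuleDecomposes.{u, w} ⊤ S) (F : SubfunctorChain.{u, w} S)
    (M : ℕ → Type (max u w)) [∀ i, AddCommGroup (M i)] [∀ i, Module S (M i)] :
    ∃ n, F.obj n (M n) ≤ F.obj (n + 1) (M n) := by
  classical
  by_contra! H
  simp_rw [SetLike.not_le_iff_exists] at H
  choose x hx hx' using H
  -- An index set larger than any finitely generated `S`-module.
  let Λ : Type (max u w) := ULift.{max u w} (Set (S ⊕ ℕ))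
  let A : ℕ → Type (max u w) := fun n ↦ Λ → M n
  obtain ⟨ι, _, N, hN, hfg⟩ := h (∀ i, A i)
  obtain ⟨π, hπN, hπ⟩ := hN.exists_projections
  obtain ⟨n, J, hJ⟩ := F.exists_forall_notMem A π fun x ↦ (hπ x).imp fun J hJ ↦ hJ.1
  let Q : Submodule S (∀ i, A i) := ⨆ j ∈ J, N j
  have hQ : Q.FG := Submodule.fg_biSup _ _ fun j _ ↦
    (Submodule.fg_iff_exists_encard_lt_top _).2 (hfg j)
  let z : Λ → A n := fun l ↦ Pi.single l (x n)
  have hz (l : Λ) : z l ∈ F.obj n (A n) := F.map_mem (LinearMap.single S (fun _ : Λ ↦ M n) l) (hx n)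
  let g : Λ → Q := fun l ↦ ⟨∑ j ∈ J, π j (Pi.single n (z l)), Submodule.sum_mem _ fun j hj ↦
    Submodule.mem_iSup_of_mem j (Submodule.mem_iSup_of_mem hj (hπN j _))⟩
  have hg : Function.Injective g := by
    intro l l' hll
    by_contra hne
    have h0 : ∑ j ∈ J, π j (Pi.single n (z l - z l')) = 0 := by
      simp_rw [Pi.single_sub, map_sub, Finset.sum_sub_distrib]
      exact sub_eq_zero.2 (congrArg Subtype.val hll)
    -- The components in `J` cancel and all others lie in `F (n + 1)`.
    have hmem : Pi.single n (z l - z l') ∈ F.obj (n + 1) (∀ i, A i) := by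
      obtain ⟨K, hK, hsum⟩ := hπ (Pi.single n (z l - z l'))
      have h1 : ∑ j ∈ K ∪ J, π j (Pi.single n (z l - z l')) = Pi.single n (z l - z l') := by
        rw [← Finset.sum_subset Finset.subset_union_left fun j _ hj ↦ hK j hj, hsum]
      rw [← Finset.sum_sdiff Finset.subset_union_right, h0, add_zero] at h1
      rw [← h1]
      exact sum_mem fun j hj ↦ hJ _ (sub_mem (hz l) (hz l')) j (Finset.mem_sdiff.1 hj).2
    have h2 := F.map_mem (LinearMap.proj l : A n →ₗ[S] M n)
      (F.map_mem (LinearMap.proj n : (∀ i, A i) →ₗ[S] A n) hmem)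
    apply hx' n
    have h3 : (Pi.single n (z l - z l') : ∀ i, A i) n l = x n := by
      rw [Pi.single_eq_same]
      change z l l - z l' l = x n
      simp [z, hne]
    rwa [LinearMap.proj_apply, LinearMap.proj_apply, h3] at h2
  have h1 := (Cardinal.lift_le.{u}.2 (Cardinal.mk_le_of_injective hg)).trans hQ.mk_le
  have h2 : max (Cardinal.mk S) Cardinal.aleph0 ≤ Cardinal.mk (S ⊕ ℕ) := by
    rw [Cardinal.mk_sum]
    simp
  have h3 := Cardinal.cantor (Cardinal.mk (S ⊕ ℕ))
  rw [← Cardinal.mk_set] at h3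
  have h4 := h2.trans_lt h3
  rw [← Cardinal.lift_lt.{u, max u w}] at h4
  refine absurd h1 (not_le.2 ?_)
  simpa [Λ] using h4

/-- The chain `M ↦ {m | I n • m = 0}` attached to an ascending sequence of left ideals. -/
def SubfunctorChain.annihilated {S : Type u} [Ring S] (I : ℕ →o Ideal S) :
    SubfunctorChain.{u, w} S where
  obj n M _ _ :=
    { carrier := {m | ∀ a ∈ I n, a • m = 0}
      add_mem' := fun hx hy a ha ↦ by rw [smul_add, hx a ha, hy a ha, add_zero]
      zero_mem' := fun a _ ↦ smul_zero a
      neg_mem' := fun hx a ha ↦ by rw [smul_neg, hx a ha, neg_zero] }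
  anti _ _ _ _ _ h _ hx a ha := hx a (I.monotone h ha)
  map_mem f _ _ hx a ha := by rw [← map_smul, hx a ha, map_zero]
  pi_mem hx a ha := funext fun i ↦ hx i a ha

/-- The chain `M ↦ p n • M`, where each `p (n + 1)` is a right multiple of `p n`. -/
def SubfunctorChain.multiples {S : Type u} [Ring S] (p c : ℕ → S)
    (hp : ∀ n, p (n + 1) = p n * c n) : SubfunctorChain.{u, w} S where
  obj n M _ _ := (DistribSMul.toAddMonoidHom M (p n)).range
  anti M _ _ := antitone_nat_of_succ_le fun n ↦ by
    rintro _ ⟨y, rfl⟩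
    exact ⟨c n • y, by simp [hp, mul_smul]⟩
  map_mem f n _ hx := by
    obtain ⟨y, rfl⟩ := hx
    exact ⟨f y, by simp⟩
  pi_mem hx := by
    choose y hy using hx
    exact ⟨y, funext hy⟩

/-! ### Chain conditions on left ideals and on principal right ideals -/

/-- In `S ⧸ I n` the class of `1` is killed by `I n`, but by `I (n + 1)` only if the two ideals
agree. -/
theorem EveryModuleDecomposes.isNoetherianRing {S : Type u} [Ring S]
    (h : EveryModuleDecomposes.{u, w} ⊤ S) : IsNoetherianRing S := by
  rw [isNoetherianRing_iff, ← monotone_stabilizes_iff_noetherian]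
  by_contra! H
  obtain ⟨I, hI⟩ := H
  choose g hg hne using hI
  -- Iterating `g` extracts a subsequence that grows at every step.
  let φ : ℕ → ℕ := fun k ↦ g^[k] 0
  have φ_succ (k : ℕ) : φ (k + 1) = g (φ k) := Function.iterate_succ_apply' g k 0
  have hφ : Monotone φ := monotone_nat_of_le_succ fun k ↦ φ_succ k ▸ hg _
  let I' : ℕ →o Ideal S := ⟨fun k ↦ I (φ k), fun _ _ hab ↦ I.monotone (hφ hab)⟩
  obtain ⟨n, hn⟩ := h.exists_obj_le (SubfunctorChain.annihilated.{u, w} I')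
    fun k ↦ ULift.{w} (S ⧸ I' k)
  have h1 : ULift.up (Submodule.Quotient.mk 1) ∈
      (SubfunctorChain.annihilated.{u, w} I').obj n (ULift.{w} (S ⧸ I' n)) := fun a ha ↦ by
    refine ULift.down_injective ?_
    change a • (Submodule.Quotient.mk 1 : S ⧸ I' n) = 0
    rw [← Submodule.Quotient.mk_smul, Submodule.Quotient.mk_eq_zero, smul_eq_mul, mul_one]
    exact ha
  refine hne (φ n) (le_antisymm (I.monotone (hg _)) fun a ha ↦ ?_)
  have h2 : a • (Submodule.Quotient.mk 1 : S ⧸ I' n) = 0 :=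
    congrArg ULift.down (hn h1 a (by change a ∈ I (φ (n + 1)); rwa [φ_succ]))
  rwa [← Submodule.Quotient.mk_smul, Submodule.Quotient.mk_eq_zero, smul_eq_mul, mul_one] at h2

/-- The descending chain condition on principal right ideals. -/
theorem EveryModuleDecomposes.exists_eq_mul {S : Type u} [Ring S]
    (h : EveryModuleDecomposes.{u, w} ⊤ S) (p c : ℕ → S) (hp : ∀ n, p (n + 1) = p n * c n) :
    ∃ n b, p n = p (n + 1) * b := by
  obtain ⟨n, hn⟩ := h.exists_obj_le (SubfunctorChain.multiples.{u, w} p c hp) fun _ ↦ ULift.{w} S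
  obtain ⟨y, hy⟩ := hn ⟨ULift.up 1, rfl⟩
  refine ⟨n, y.down, ?_⟩
  have := congrArg ULift.down hy
  simpa using this.symm

/-! ### From principal right ideals to semiprimary rings -/

section PrincipalRightIdeals

variable {S : Type u} [Ring S]

theorem wellFounded_of_forall_exists_eq_mul
    (h : ∀ p c : ℕ → S, (∀ n, p (n + 1) = p n * c n) → ∃ n b, p n = p (n + 1) * b) :
    WellFounded fun y x : S ↦ (∃ c, y = x * c) ∧ ¬∃ b, x = y * b := by
  rw [wellFounded_iff_isEmpty_descending_chain]
  refine ⟨fun ⟨p, hp⟩ ↦ ?_⟩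
  choose c hc using fun n ↦ (hp n).1
  obtain ⟨n, hn⟩ := h p c hc
  exact (hp n).2 hn

/-- A left inverse `z` of `1 - a` equals `1 + z * a`, so it is left invertible as well and hence a
unit. -/
theorem isUnit_one_sub_of_mem_jacobson {a : S} (ha : a ∈ Ring.jacobson S) : IsUnit (1 - a) := by
  have key {a : S} (ha : a ∈ Ring.jacobson S) : ∃ z, z * (1 - a) = 1 := by
    rw [← Ideal.jacobson_bot] at ha
    obtain ⟨z, hz⟩ := Ideal.mem_jacobson_iff.1 ha (-1)
    refine ⟨z, sub_eq_zero.1 ?_⟩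
    rw [← (Submodule.mem_bot S).1 hz]
    noncomm_ring
  obtain ⟨z, hz⟩ := key ha
  obtain ⟨y, hy⟩ := key (neg_mem (Ideal.mul_mem_left _ z ha))
  have hz' : 1 - -(z * a) = z := by
    rw [mul_sub, mul_one, sub_eq_iff_eq_add] at hz
    rw [sub_neg_eq_add, ← hz]
  rw [hz'] at hy
  have : y = 1 - a := left_inv_eq_right_inv hy hz
  exact ⟨⟨1 - a, z, this ▸ hy, hz⟩, rfl⟩

theorem eq_zero_of_eq_mul_mul_of_mem_jacobson {x a b : S} (ha : a ∈ Ring.jacobson S)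
    (h : x = x * a * b) : x = 0 := by
  refine (isUnit_one_sub_of_mem_jacobson (Ideal.mul_mem_right b _ ha)).mul_left_eq_zero.1 ?_
  rw [mul_sub, mul_one, ← mul_assoc, ← h, sub_self]

/-- Here `y * a` squares to zero, so `1 - y * a` inverts `1 + y * a`. -/
theorem mem_jacobson_of_forall_mul_mul_eq_zero {a : S} (h : ∀ s, a * s * a = 0) :
    a ∈ Ring.jacobson S := by
  rw [← Ideal.jacobson_bot, Ideal.mem_jacobson_iff]
  intro y
  refine ⟨1 - y * a, ?_⟩
  rw [Submodule.mem_bot]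
  have : (1 - y * a) * y * a + (1 - y * a) - 1 = - (y * (a * y * a)) := by noncomm_ring
  rw [this, h, mul_zero, neg_zero]

/-- In a left noetherian ring with the descending chain condition on principal right ideals the
Jacobson radical is nilpotent. -/
theorem isNilpotent_jacobson_of_forall_exists_eq_mul [IsNoetherianRing S]
    (h : ∀ p c : ℕ → S, (∀ n, p (n + 1) = p n * c n) → ∃ n b, p n = p (n + 1) * b) :
    IsNilpotent (Ring.jacobson S) := by
  set J := Ring.jacobson S with hJ
  let L : ℕ →o Ideal S :=
    { toFun := fun n ↦
        { carrier := {x | ∀ y ∈ J ^ n, x * y = 0}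
          add_mem' := fun hx hx' y hy ↦ by rw [add_mul, hx y hy, hx' y hy, add_zero]
          zero_mem' := fun y _ ↦ zero_mul y
          smul_mem' := fun s x hx y hy ↦ by rw [smul_eq_mul, mul_assoc, hx y hy, mul_zero] }
      monotone' := fun m n hmn x hx y hy ↦ hx y (Ideal.pow_le_pow_right hmn hy) }
  obtain ⟨n, hn⟩ := monotone_stabilizes_iff_noetherian.2 ‹IsNoetherianRing S› L
  refine ⟨n, ?_⟩
  by_contra hne
  have h1 : (1 : S) ∉ L n := fun h1 ↦ hne <| (Submodule.eq_bot_iff _).2 fun y hy ↦ by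
    rw [← one_mul y, h1 y hy]
  -- If `x * a` killed `J ^ n` for every `a ∈ J`, then `x` would kill `J ^ (n + 1)`, hence `J ^ n`
  -- by stability.
  have step (x : S) (hx : x ∉ L n) : ∃ a ∈ J, x * a ∉ L n := by
    by_contra! H
    refine hx ?_
    rw [hn (n + 1) n.le_succ]
    intro y hy
    rw [Ideal.IsTwoSided.pow_succ] at hy
    refine Submodule.smul_induction_on hy (fun r hr z hz ↦ ?_) fun z z' hz hz' ↦ ?_
    · rw [smul_eq_mul, ← mul_assoc, H r hr z hz]
    · rw [mul_add, hz, hz', add_zero]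
  choose! a haJ ha using step
  let p : ℕ → S := fun k ↦ Nat.rec 1 (fun _ x ↦ x * a x) k
  have hp (k : ℕ) : p k ∉ L n := by
    induction k with
    | zero => exact h1
    | succ k ih => exact ha _ ih
  obtain ⟨k, b, hb⟩ := h p (fun k ↦ a (p k)) fun _ ↦ rfl
  refine hp k ?_
  rw [eq_zero_of_eq_mul_mul_of_mem_jacobson (haJ _ (hp k)) hb]
  exact zero_mem _

/-- A ring with zero Jacobson radical and the descending chain condition on principal right ideals
is semisimple. -/
theorem isSemisimpleRing_of_forall_exists_eq_mul (hJ : Ring.jacobson S = ⊥)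
    (h : ∀ p c : ℕ → S, (∀ n, p (n + 1) = p n * c n) → ∃ n b, p n = p (n + 1) * b) :
    IsSemisimpleRing S := by
  have wf := wellFounded_of_forall_exists_eq_mul h
  let soc : Submodule Sᵐᵒᵖ S := sSup {m | IsSimpleModule Sᵐᵒᵖ m}
  have mul_mem_soc {x : S} (hx : x ∈ soc) (s : S) : x * s ∈ soc := soc.smul_mem (.op s) hx
  -- every nonzero principal right ideal contains an idempotent generating a minimal right ideal
  have minimal (x : S) (hx : x ≠ 0) : ∃ f ∈ soc, f ≠ 0 ∧ f * f = f ∧ ∃ c, f = x * c := by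
    obtain ⟨y, ⟨hy0, c, hc⟩, hy⟩ := wf.has_min {y | y ≠ 0 ∧ ∃ c, y = x * c} ⟨x, hx, 1, by simp⟩
    have hmin (s : S) (hs : y * s ≠ 0) : ∃ b, y = y * s * b := by
      by_contra H
      exact hy (y * s) ⟨hs, c * s, by rw [hc, mul_assoc]⟩ ⟨⟨s, rfl⟩, H⟩
    have hsq : ∃ s, y * s * y ≠ 0 := by
      by_contra! H
      exact hy0 (by simpa [hJ] using mem_jacobson_of_forall_mul_mul_eq_zero H)
    obtain ⟨s, hs⟩ := hsq
    obtain ⟨b, hb⟩ := hmin (s * y) (by rwa [← mul_assoc])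
    have hysoc : y ∈ soc := by
      have hmem : y ∈ Submodule.span Sᵐᵒᵖ {y} := Submodule.mem_span_singleton_self y
      refine (le_sSup (α := Submodule Sᵐᵒᵖ S) (a := Submodule.span Sᵐᵒᵖ {y}) ?_) hmem
      rw [Set.mem_ofPred_eq, isSimpleModule_iff_isAtom]
      refine ⟨fun h0 ↦ hy0 (by rwa [Submodule.span_singleton_eq_bot] at h0), fun K hK ↦ ?_⟩
      by_contra hK0
      obtain ⟨k, hkK, hk0⟩ := Submodule.exists_mem_ne_zero_of_ne_bot hK0
      obtain ⟨t, rfl⟩ := Submodule.mem_span_singleton.1 (hK.le hkK)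
      obtain ⟨b, hb⟩ := hmin t.unop hk0
      refine hK.not_ge ((Submodule.span_singleton_le_iff_mem _ _).2 ?_)
      rw [hb]
      exact K.smul_mem (.op b) hkK
    -- Left multiplication by `y * s` is injective on the minimal right ideal `y S`, and by `hu` it
    -- fixes `y * s` after right multiplication by `y * (b * s)`; this forces the latter to be
    -- idempotent.
    have hcancel (r : S) (hr : y * s * (y * r) = 0) : y * r = 0 := by
      by_contra hr0
      obtain ⟨b', hb'⟩ := hmin r hr0
      have h2 : y * s * y = y * s * (y * r * b') := congrArg (y * s * ·) hb'
      exact hs (by rw [h2, ← mul_assoc, hr, zero_mul])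
    have hu : y * s * (y * (b * s)) = y * s := by
      conv_rhs => rw [hb]
      simp only [mul_assoc]
    refine ⟨y * (b * s), mul_mem_soc hysoc _, fun h0 ↦ hs ?_, ?_, c * (b * s), ?_⟩
    · rw [← hu, h0, mul_zero, zero_mul]
    · have := hcancel (b * s * (y * (b * s)) - b * s) (by
        rw [mul_sub, mul_sub, ← mul_assoc y, ← mul_assoc (y * s), hu, hu, sub_self])
      rwa [mul_sub, ← mul_assoc, sub_eq_zero] at this
    · rw [hc, mul_assoc]
  -- Choose an idempotent `e` of the socle with `(1 - e) S` minimal. If `e ≠ 1`, an idempotent `f`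
  -- of the socle in `(1 - e) S` enlarges it to `e + f * (1 - e)`.
  obtain ⟨q, ⟨e, he, hesoc, rfl⟩, hmin⟩ := wf.has_min
    {q | ∃ e : S, e * e = e ∧ e ∈ soc ∧ q = 1 - e} ⟨1, 0, by simp, soc.zero_mem, by simp⟩
  have he1 : 1 - e = 0 := by
    by_contra hne
    obtain ⟨f, hfsoc, hf0, hff, c, hc⟩ := minimal (1 - e) hne
    have hef : e * f = 0 := by rw [hc, ← mul_assoc, mul_sub, he, mul_one, sub_self, zero_mul]
    have hef' : e * (f * (1 - e)) = 0 := by rw [← mul_assoc, hef, zero_mul]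
    have he'e : (1 - e) * (1 - e) = 1 - e := by
      rw [mul_sub, mul_one, sub_mul, one_mul, he, sub_self, sub_zero]
    have hfe : f * (1 - e) * e = 0 := by
      rw [mul_assoc, sub_mul, one_mul, he, sub_self, mul_zero]
    have hff' : f * (1 - e) * f = f := by
      rw [mul_assoc, sub_mul, one_mul, hef, sub_zero, hff]
    have hidem : (e + f * (1 - e)) * (e + f * (1 - e)) = e + f * (1 - e) := by
      rw [add_mul, mul_add, mul_add, he, hef', hfe, ← mul_assoc (f * (1 - e)), hff', add_zero,
        zero_add]
    refine hmin (1 - (e + f * (1 - e))) ⟨e + f * (1 - e), ?_, ?_, rfl⟩ ⟨⟨1 - f * (1 - e), ?_⟩, ?_⟩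
    · exact hidem
    · exact add_mem hesoc (mul_mem_soc hfsoc _)
    · rw [sub_mul 1 e, one_mul, mul_sub e, mul_one, hef', sub_zero]
      abel
    · rintro ⟨b, hb⟩
      have h0 : (e + f * (1 - e)) * (1 - e) = 0 := by
        have h2 := congrArg ((e + f * (1 - e)) * ·) hb
        refine h2.trans ?_
        rw [← mul_assoc, mul_sub (e + f * (1 - e)), mul_one, hidem, sub_self, zero_mul]
      rw [add_mul, mul_sub e, mul_one, he, sub_self, zero_add, mul_assoc, he'e] at h0
      rw [h0, zero_mul] at hff'
      exact hf0 hff'.symm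
  have htop : soc = ⊤ := by
    refine (eq_top_iff).2 fun x _ ↦ ?_
    rw [← one_mul x, sub_eq_zero.1 he1]
    exact mul_mem_soc hesoc x
  have : IsSemisimpleModule Sᵐᵒᵖ S := IsSemisimpleModule.of_sSup_simples_eq_top htop
  rw [← isSemisimpleRing_mulOpposite_iff]
  exact (MulOpposite.opLinearEquiv Sᵐᵒᵖ : S ≃ₗ[Sᵐᵒᵖ] Sᵐᵒᵖ).isSemisimpleModule_iff.1 this

end PrincipalRightIdeals

theorem EveryModuleDecomposes.isArtinianRing {S : Type u} [Ring S]
    (h : EveryModuleDecomposes.{u, w} ⊤ S) : IsArtinianRing S := by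
  have := h.isNoetherianRing
  have hq : EveryModuleDecomposes.{u, w} ⊤ (S ⧸ Ring.jacobson S) :=
    EveryModuleDecomposes.of_surjective.{u, u, w} h (Ideal.Quotient.mk _)
      Ideal.Quotient.mk_surjective
  have : IsSemiprimaryRing S :=
    ⟨isSemisimpleRing_of_forall_exists_eq_mul (Ring.jacobson_quotient_jacobson S) hq.exists_eq_mul,
      isNilpotent_jacobson_of_forall_exists_eq_mul h.exists_eq_mul⟩
  exact IsSemiprimaryRing.isNoetherian_iff_isArtinian.1 ‹_›

/-! ### The FC-center and coset coverings -/

section FCCenter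

variable {G : Type*} [Group G]

/-- Orbit-stabilizer for conjugation. -/
theorem Subgroup.finiteIndex_centralizer_singleton_iff (g : G) :
    (Subgroup.centralizer {g}).FiniteIndex ↔ (conjugatesOf g).Finite := by
  have key (x y : G) : x * g * x⁻¹ = y * g * y⁻¹ ↔ x⁻¹ * y ∈ Subgroup.centralizer {g} := by
    rw [Subgroup.mem_centralizer_singleton_iff]
    constructor <;> intro h
    · have := congrArg (fun z ↦ x⁻¹ * z * y) h
      simpa [mul_assoc] using this.symm
    · have := congrArg (fun z ↦ x * z * y⁻¹) h
      simpa [mul_assoc] using this.symm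
  let φ : G ⧸ Subgroup.centralizer {g} → G := Quotient.lift (fun x ↦ x * g * x⁻¹) fun x y h ↦
    (key x y).2 (QuotientGroup.leftRel_apply.1 h)
  have hφ : Function.Injective φ := by
    intro x y
    induction x using QuotientGroup.induction_on
    induction y using QuotientGroup.induction_on
    intro h
    exact QuotientGroup.eq.2 ((key _ _).1 h)
  have hr : Set.range φ = conjugatesOf g := by
    ext z
    change _ ↔ IsConj g z
    rw [isConj_iff]
    constructor
    · rintro ⟨x, rfl⟩
      induction x using QuotientGroup.induction_on with | H x => exact ⟨x, rfl⟩
    · rintro ⟨x, rfl⟩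
      exact ⟨x, rfl⟩
  rw [Subgroup.finiteIndex_iff_finite_quotient, ← hr]
  exact ⟨fun _ ↦ Set.finite_range φ, fun h ↦ have := h.to_subtype; .of_injective _ (
    Set.rangeFactorization_injective.2 hφ)⟩

variable (G) in
/-- The subgroup of elements with finitely many conjugates. -/
def Subgroup.fcCenter : Subgroup G where
  carrier := {g | (conjugatesOf g).Finite}
  mul_mem' {a b} ha hb := (Set.Finite.mul ha hb).subset fun z hz ↦ by
    obtain ⟨c, rfl⟩ := isConj_iff.1 hz
    exact ⟨c * a * c⁻¹, isConj_iff.2 ⟨c, rfl⟩, c * b * c⁻¹, isConj_iff.2 ⟨c, rfl⟩, by group⟩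
  one_mem' := (Set.finite_singleton 1).subset fun z hz ↦ by
    obtain ⟨c, rfl⟩ := isConj_iff.1 hz
    simp
  inv_mem' {a} ha := (Set.Finite.inv ha).subset fun z hz ↦ by
    obtain ⟨c, rfl⟩ := isConj_iff.1 hz
    exact isConj_iff.2 ⟨c, by group⟩

theorem Subgroup.mem_fcCenter {g : G} : g ∈ Subgroup.fcCenter G ↔ (conjugatesOf g).Finite := Iff.rfl

instance Subgroup.normal_fcCenter : (Subgroup.fcCenter G).Normal where
  conj_mem g hg c := by
    have : IsConj g (c * g * c⁻¹) := isConj_iff.2 ⟨c, rfl⟩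
    rw [mem_fcCenter] at hg ⊢
    rwa [← this.conjugatesOf_eq]

theorem Subgroup.fcCenter_quotient_fcCenter_eq_bot [Finite (Subgroup.fcCenter G)] :
    Subgroup.fcCenter (G ⧸ Subgroup.fcCenter G) = ⊥ := by
  rw [Subgroup.eq_bot_iff_forall]
  intro x hx
  induction x using QuotientGroup.induction_on with | H g => ?_
  rw [QuotientGroup.eq_one_iff, mem_fcCenter]
  refine (Set.Finite.preimage' (f := ((↑) : G → G ⧸ Subgroup.fcCenter G)) hx
    fun y _ ↦ ?_).subset fun z hz ↦ ?_
  · induction y using QuotientGroup.induction_on with | H y => ?_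
    refine ((Set.toFinite (Subgroup.fcCenter G : Set G)).image (y * ·)).subset fun z hz ↦ ?_
    exact ⟨y⁻¹ * z, QuotientGroup.eq.1 (Set.mem_singleton_iff.1 hz).symm, by simp⟩
  · obtain ⟨c, rfl⟩ := isConj_iff.1 hz
    exact isConj_iff.2 ⟨c, rfl⟩

theorem Subgroup.fg_of_wellFoundedGT [WellFoundedGT (Subgroup G)] (H : Subgroup G) : H.FG := by
  obtain ⟨K, ⟨hK, hKH⟩, hmax⟩ := wellFounded_gt.has_min {K : Subgroup G | K.FG ∧ K ≤ H}
    ⟨⊥, Subgroup.FG.bot, bot_le⟩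
  suffices H ≤ K by rwa [le_antisymm this hKH]
  intro x hx
  by_contra hxK
  refine hmax (K ⊔ Subgroup.closure {x}) ⟨hK.sup ⟨{x}, by simp⟩, sup_le hKH (by simpa)⟩ ?_
  refine lt_of_le_of_ne le_sup_left fun h ↦ hxK ?_
  rw [h]
  exact Subgroup.mem_sup_right (Subgroup.subset_closure rfl)

theorem isOfFinOrder_of_wellFoundedLT_subgroup [WellFoundedLT (Subgroup G)] (g : G) :
    IsOfFinOrder g := by
  let f : ℕ →o (Subgroup G)ᵒᵈ := ⟨fun n ↦ OrderDual.toDual (Subgroup.zpowers (g ^ 2 ^ n)),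
    monotone_nat_of_le_succ fun n ↦ by
      change Subgroup.zpowers (g ^ 2 ^ (n + 1)) ≤ Subgroup.zpowers (g ^ 2 ^ n)
      rw [Subgroup.zpowers_le, pow_succ, pow_mul]
      exact pow_mem (Subgroup.mem_zpowers _) _⟩
  obtain ⟨n, hn⟩ := WellFoundedGT.monotone_chain_condition f
  have h : Subgroup.zpowers (g ^ 2 ^ n) = Subgroup.zpowers (g ^ 2 ^ (n + 1)) := hn _ n.le_succ
  obtain ⟨k, hk⟩ := Subgroup.mem_zpowers_iff.1 (h ▸ Subgroup.mem_zpowers (g ^ 2 ^ n))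
  rw [← zpow_natCast, ← zpow_natCast, ← zpow_mul] at hk
  rw [isOfFinOrder_iff_zpow_eq_one]
  -- The exponent is `2 ^ n * (2 * k - 1)`, nonzero because the second factor is odd.
  refine ⟨(2 ^ (n + 1) : ℕ) * k - (2 ^ n : ℕ), fun h0 ↦ ?_, by rw [zpow_sub, hk, mul_inv_cancel]⟩
  have h1 : (2 ^ n : ℤ) * (2 * k - 1) = 0 := by
    push_cast at h0
    rw [← h0]
    ring
  rcases mul_eq_zero.1 h1 with h2 | h2
  · exact absurd h2 (by positivity)
  · omega

/-- The FC-center `Δ` is finitely generated, so the centralizer `C` of its generators has finite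
index. Then `C ⊓ Δ` is abelian, finitely generated and torsion, hence finite, and its cosets in `Δ`
inject into `G ⧸ C`. -/
theorem Subgroup.finite_fcCenter [WellFoundedGT (Subgroup G)] [WellFoundedLT (Subgroup G)] :
    Finite (Subgroup.fcCenter G) := by
  obtain ⟨s, hs⟩ := Subgroup.fg_of_wellFoundedGT (Subgroup.fcCenter G)
  let C : Subgroup G := Subgroup.centralizer (s : Set G)
  have hC : C.FiniteIndex := by
    have : C = ⨅ g ∈ s, Subgroup.centralizer {g} := Subgroup.centralizer_eq_iInf _
    rw [this]
    refine Subgroup.finiteIndex_iInf' _ fun g hg ↦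
      (Subgroup.finiteIndex_centralizer_singleton_iff g).2 (Subgroup.mem_fcCenter.1 ?_)
    rw [← hs]
    exact Subgroup.subset_closure hg
  let Z : Subgroup G := C ⊓ Subgroup.fcCenter G
  have hcomm (x y : Z) : x * y = y * x := by
    have hx : (x : G) ∈ Subgroup.centralizer (Subgroup.fcCenter G : Set G) := by
      rw [← hs, Subgroup.centralizer_closure]
      exact x.2.1
    exact Subtype.ext (hx y y.2.2).symm
  let : CommGroup Z := { (inferInstance : Group Z) with mul_comm := hcomm }
  have : Group.FG Z := (Group.fg_iff_subgroup_fg Z).2 (Subgroup.fg_of_wellFoundedGT Z)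
  have : Finite Z := CommGroup.finite_of_fg_isMulTorsion Z fun x ↦
    Submonoid.isOfFinOrder_coe.1 (isOfFinOrder_of_wellFoundedLT_subgroup (x : G))
  have : Finite (G ⧸ C) := Subgroup.finite_quotient_of_finiteIndex
  refine Set.Finite.to_subtype (s := (Subgroup.fcCenter G : Set G)) ?_
  have hfin := Set.Finite.of_finite_fibers (s := (Subgroup.fcCenter G : Set G))
    (f := ((↑) : G → G ⧸ C)) (Set.toFinite _)
  refine hfin fun y hy ↦ ?_
  obtain ⟨y, hyΔ, rfl⟩ := hy
  refine ((Set.toFinite (Z : Set G)).image (y * ·)).subset fun z hz ↦ ?_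
  exact ⟨y⁻¹ * z, ⟨QuotientGroup.eq.1 (Set.mem_singleton_iff.1 hz.2).symm,
    (Subgroup.fcCenter G).mul_mem ((Subgroup.fcCenter G).inv_mem hyΔ) hz.1⟩, by simp⟩

open scoped Pointwise in
/-- If no element of the finite set `s` has finitely many conjugates, some conjugation moves `s`
off a given finite set `t`. -/
theorem exists_conj_notMem_of_fcCenter (s t : Finset G) (hs : ∀ c ∈ s, c ∉ Subgroup.fcCenter G) :
    ∃ g : G, ∀ c ∈ s, g⁻¹ * c * g ∉ t := by
  classical
  by_contra! H
  let P : G × G → G → Prop := fun p g ↦ g * p.1 * g⁻¹ = p.2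
  -- The conjugators from `c` to `d` form a coset of the centralizer of `c` or the empty set; in the
  -- latter case the default `1` only adds a harmless coset of the same subgroup.
  let r : G × G → G := fun p ↦ if h : ∃ g, P p g then h.choose else 1
  have hcov : ⋃ p ∈ s ×ˢ t, r p • (Subgroup.centralizer {p.1} : Set G) = Set.univ := by
    refine Set.eq_univ_of_forall fun g ↦ ?_
    obtain ⟨c, hc, hct⟩ := H g⁻¹
    rw [inv_inv] at hct
    refine Set.mem_biUnion (x := (c, g * c * g⁻¹)) (by simp [hc, hct]) ?_
    have hex : ∃ g', P (c, g * c * g⁻¹) g' := ⟨g, rfl⟩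
    have hr : r (c, g * c * g⁻¹) * c * (r (c, g * c * g⁻¹))⁻¹ = g * c * g⁻¹ := by
      simp only [r, dif_pos hex]
      exact hex.choose_spec
    rw [Set.mem_smul_set_iff_inv_smul_mem, smul_eq_mul, SetLike.mem_coe,
      Subgroup.mem_centralizer_singleton_iff]
    set q := r (c, g * c * g⁻¹)
    have := congrArg (fun z ↦ q⁻¹ * z * g) hr
    simpa [mul_assoc] using this.symm
  obtain ⟨p, hp, hfin⟩ := Subgroup.exists_finiteIndex_of_leftCoset_cover hcov
  exact hs p.1 (Finset.mem_product.1 hp).1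
    ((Subgroup.finiteIndex_centralizer_singleton_iff p.1).1 hfin)

end FCCenter

/-! ### Semiprime artinian rings and artinian group rings -/

/-- The last nonzero power of the radical, if beyond the first, would consist of elements with `a S
a = 0`; the same reasoning applies to the radical itself. -/
theorem isSemisimpleRing_of_isArtinianRing_of_semiprime {S : Type*} [Ring S] [IsArtinianRing S]
    (h : ∀ a : S, (∀ s, a * s * a = 0) → a = 0) : IsSemisimpleRing S := by
  rw [IsArtinianRing.isSemisimpleRing_iff_jacobson]
  obtain ⟨n, hn⟩ := IsSemiprimaryRing.isNilpotent (R := S)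
  have key (n : ℕ) (hn : Ring.jacobson S ^ (n + 1) = ⊥) : Ring.jacobson S = ⊥ := by
    induction n with
    | zero => rwa [Submodule.pow_one] at hn
    | succ n ih =>
      refine ih ((Submodule.eq_bot_iff _).2 fun a ha ↦ h a fun s ↦ ?_)
      have haJ : a ∈ Ring.jacobson S :=
        Ideal.mul_le_right (I := Ring.jacobson S ^ n) (J := Ring.jacobson S) ha
      have has : a * s ∈ Ring.jacobson S ^ (n + 1) :=
        Ideal.mul_mem_right s (Ring.jacobson S ^ (n + 1)) ha
      have hmem : a * s * a ∈ Ring.jacobson S ^ (n + 1) * Ring.jacobson S :=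
        Ideal.mul_mem_mul has haJ
      rwa [← Submodule.pow_succ, hn, Submodule.mem_bot] at hmem
  refine key n ?_
  rw [Submodule.pow_succ, hn]
  exact zero_mul _

namespace MonoidAlgebra

section SurjectiveMaps

variable {R : Type*} {S : Type*} {G H : Type*} [Ring R] [Ring S] [Group G] [Group H]

theorem surjective_mapRingHom_comp_mapDomainRingHom {f : R →+* S} (hf : Function.Surjective f)
    {φ : G →* H} (hφ : Function.Surjective φ) :
    Function.Surjective ((mapRingHom H f).comp (mapDomainRingHom R φ)) := by
  intro x
  induction x using MonoidAlgebra.induction_linear with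
  | zero => exact ⟨0, map_zero _⟩
  | add x y hx hy =>
    obtain ⟨a, rfl⟩ := hx
    obtain ⟨b, rfl⟩ := hy
    exact ⟨a + b, map_add _ _ _⟩
  | single h s =>
    obtain ⟨g, rfl⟩ := hφ h
    obtain ⟨r, rfl⟩ := hf s
    exact ⟨single g r, by simp⟩

variable (R G) in
/-- The augmentation map `∑ r_g g ↦ ∑ r_g` of a group ring. -/
noncomputable def augmentation : MonoidAlgebra R G →+* R :=
  liftNCRingHom (RingHom.id R) 1 fun x _ ↦ Commute.one_right x

theorem augmentation_single (g : G) (r : R) : augmentation R G (single g r) = r := by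
  simp [augmentation]

theorem surjective_augmentation : Function.Surjective (augmentation R G) :=
  fun r ↦ ⟨single 1 r, augmentation_single 1 r⟩

end SurjectiveMaps

variable {R G : Type*} [Ring R] [Group G]

variable (R) in
/-- The left ideal of the group ring generated by the elements `h - 1`, `h ∈ H`. -/
noncomputable def subgroupIdeal (H : Subgroup G) : Ideal (MonoidAlgebra R G) :=
  Ideal.span ((fun h ↦ single h 1 - 1) '' (H : Set G))

theorem single_sub_one_mem_subgroupIdeal_iff [Nontrivial R] {H : Subgroup G} {g : G} :
    single g 1 - 1 ∈ subgroupIdeal R H ↔ g ∈ H := by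
  refine ⟨fun hg ↦ ?_, fun hg ↦ Ideal.subset_span ⟨g, hg, rfl⟩⟩
  let φ : MonoidAlgebra R G →+ (G ⧸ H →₀ R) :=
    (Finsupp.mapDomain.addMonoidHom ((↑) : G → G ⧸ H)).comp coeffAddEquiv.toAddMonoidHom
  have φ_single (x : G) (a : R) : φ (single x a) = Finsupp.single (x : G ⧸ H) a :=
    Finsupp.mapDomain_single
  -- The largest left ideal inside the kernel of `φ`.
  let K : Ideal (MonoidAlgebra R G) :=
    { carrier := {x | ∀ a, φ (a * x) = 0}
      add_mem' := fun hx hy a ↦ by rw [mul_add, map_add, hx, hy, add_zero]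
      zero_mem' := fun a ↦ by rw [mul_zero, map_zero]
      smul_mem' := fun c x hx a ↦ by rw [smul_eq_mul, ← mul_assoc, hx] }
  have hK : subgroupIdeal R H ≤ K := by
    refine Ideal.span_le.2 ?_
    rintro _ ⟨h, hh, rfl⟩ a
    induction a using MonoidAlgebra.induction_linear with
    | zero => rw [zero_mul, map_zero]
    | add a b ha hb => rw [add_mul, map_add, ha, hb, add_zero]
    | single x r =>
      rw [mul_sub, mul_one, single_mul_single, mul_one, map_sub, φ_single, φ_single, sub_eq_zero,
        QuotientGroup.mk_mul_of_mem x hh]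
  have h := hK hg 1
  rw [one_mul, map_sub, one_def, φ_single, φ_single, sub_eq_zero,
    Finsupp.single_left_inj one_ne_zero] at h
  simpa using QuotientGroup.eq.1 h.symm

theorem strictMono_subgroupIdeal [Nontrivial R] :
    StrictMono (subgroupIdeal R : Subgroup G → Ideal (MonoidAlgebra R G)) := by
  refine Monotone.strictMono_of_injective (fun H K h ↦ Ideal.span_mono (Set.image_mono h))
    fun H K h ↦ ?_
  ext g
  rw [← single_sub_one_mem_subgroupIdeal_iff (R := R), h, single_sub_one_mem_subgroupIdeal_iff]

/-- A further contribution at `a * g * b` needs some `c ≠ a` in the support of `x` with `g⁻¹ * (c⁻¹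
* a) * g` in `supp y * b⁻¹`. Since `c⁻¹ * a` has infinitely many conjugates, one `g` avoids all
these coincidences. -/
theorem exists_coeff_mul_single_mul (hG : Subgroup.fcCenter G = ⊥) (x y : MonoidAlgebra R G)
    (a b : G) : ∃ g, ∀ r, (x * (single g r * y)).coeff (a * g * b) =
      x.coeff a * (r * y.coeff b) := by
  classical
  obtain ⟨g, hg⟩ := exists_conj_notMem_of_fcCenter
    ((x.coeff.support.erase a).image fun c ↦ c⁻¹ * a) (y.coeff.support.image (· * b⁻¹)) (by
      intro c hc
      obtain ⟨d, hd, rfl⟩ := Finset.mem_image.1 hc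
      rw [hG, Subgroup.mem_bot, inv_mul_eq_one]
      exact (Finset.mem_erase.1 hd).1)
  refine ⟨g, fun r ↦ ?_⟩
  rw [coeff_mul_apply_left, Finsupp.sum, Finset.sum_eq_single a]
  · rw [coeff_single_mul_apply]
    congr 3
    group
  · intro c hc hca
    rw [coeff_single_mul_apply]
    have := hg (c⁻¹ * a) (Finset.mem_image_of_mem _ (Finset.mem_erase.2 ⟨hca, hc⟩))
    have h0 : y.coeff (g⁻¹ * (c⁻¹ * (a * g * b))) = 0 := by
      by_contra hne
      refine this (Finset.mem_image.2 ⟨_, Finsupp.mem_support_iff.2 hne, ?_⟩)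
      group
    rw [h0, mul_zero, mul_zero]
  · intro ha
    rw [Finsupp.notMem_support_iff.1 ha, zero_mul]

/-- For `y` in a complement of the augmentation ideal, `(g - 1) * y` lies in both, so `y` is
invariant and its support is a union of translates of `G`. -/
theorem finite_of_isSemisimpleRing [Nontrivial R] [IsSemisimpleRing (MonoidAlgebra R G)] :
    Finite G := by
  obtain ⟨C, hC⟩ := exists_isCompl (RingHom.ker (augmentation R G))
  have hC0 : C ≠ ⊥ := by
    rintro rfl
    have h1 : (1 : MonoidAlgebra R G) ∈ RingHom.ker (augmentation R G) := by
      rw [eq_top_of_isCompl_bot hC]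
      trivial
    rw [RingHom.mem_ker, map_one] at h1
    exact one_ne_zero h1
  obtain ⟨y, hy, hy0⟩ := Submodule.exists_mem_ne_zero_of_ne_bot hC0
  have hinv (g : G) : single g 1 * y = y := by
    have h1 : (single g 1 - 1) * y ∈ RingHom.ker (augmentation R G) := by
      rw [RingHom.mem_ker, map_mul, map_sub, augmentation_single, map_one, sub_self, zero_mul]
    have h2 := (Submodule.disjoint_def.1 hC.disjoint) _ h1 (C.smul_mem _ hy)
    rwa [sub_mul, one_mul, sub_eq_zero] at h2
  obtain ⟨b, hb⟩ : ∃ b, y.coeff b ≠ 0 := by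
    by_contra! H
    exact hy0 (coeff_injective (Finsupp.ext H))
  refine Finite.of_injective (fun g : G ↦ (⟨g * b, ?_⟩ : y.coeff.support)) fun g h hgh ↦ ?_
  · rw [Finsupp.mem_support_iff, ← hinv g, coeff_single_mul_apply]
    simpa using hb
  · exact mul_right_cancel (congrArg Subtype.val hgh)

/-- A group whose group ring over a nonzero ring is left artinian is finite. -/
theorem finite_of_isArtinianRing [Nontrivial R] [IsArtinianRing (MonoidAlgebra R G)] :
    Finite G := by
  have : WellFoundedGT (Subgroup G) := (strictMono_subgroupIdeal (R := R)).wellFoundedGT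
  have : WellFoundedLT (Subgroup G) := (strictMono_subgroupIdeal (R := R)).wellFoundedLT
  have : Finite (Subgroup.fcCenter G) := Subgroup.finite_fcCenter
  let R' := R ⧸ Ring.jacobson R
  let G' := G ⧸ Subgroup.fcCenter G
  have : Nontrivial R' := Ideal.Quotient.nontrivial_iff.2 (Ring.jacobson_lt_top R).ne
  have : IsArtinianRing (MonoidAlgebra R' G') :=
    (surjective_mapRingHom_comp_mapDomainRingHom
      (Ideal.Quotient.mk_surjective (I := Ring.jacobson R))
      (QuotientGroup.mk'_surjective (Subgroup.fcCenter G))).isArtinianRing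
  -- Each coefficient `c` of an `x` with `x s x = 0` for all `s` satisfies `c r c = 0` for all `r`,
  -- so it lies in the radical of `R'`, which is zero.
  have : IsSemisimpleRing (MonoidAlgebra R' G') := by
    refine isSemisimpleRing_of_isArtinianRing_of_semiprime fun x hx ↦ ?_
    refine coeff_injective (Finsupp.ext fun a ↦ ?_)
    obtain ⟨g, hg⟩ := exists_coeff_mul_single_mul
      (Subgroup.fcCenter_quotient_fcCenter_eq_bot (G := G)) x x a a
    have := mem_jacobson_of_forall_mul_mul_eq_zero (a := x.coeff a) fun r ↦ by
      rw [mul_assoc, ← hg r, ← mul_assoc, hx]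
      rfl
    rwa [Ring.jacobson_quotient_jacobson] at this
  have : Finite G' := finite_of_isSemisimpleRing (R := R')
  exact Finite.of_equiv _ (Subgroup.groupEquivQuotientProdSubgroup (s := Subgroup.fcCenter G)).symm

end MonoidAlgebra

/-! ### Translation to the four notions and conclusion -/

theorem isLeftPureSemisimple_iff {S : Type u} [Ring S] :
    IsLeftPureSemisimple.{u, w} S ↔ EveryModuleDecomposes.{u, w} ⊤ S := by
  simp_rw [IsLeftPureSemisimple, EveryModuleDecomposes, Submodule.fg_iff_exists_encard_lt_top]

theorem isLeftKothe_iff {S : Type u} [Ring S] :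
    IsLeftKothe.{u, w} S ↔ EveryModuleDecomposes.{u, w} 2 S := by
  simp_rw [IsLeftKothe, EveryModuleDecomposes, Submodule.isPrincipal_iff_exists_encard_lt_two]

theorem isRightPureSemisimple_iff {S : Type u} [Ring S] :
    IsRightPureSemisimple.{u, w} S ↔ EveryModuleDecomposes.{u, w} ⊤ Sᵐᵒᵖ :=
  isLeftPureSemisimple_iff (S := Sᵐᵒᵖ)

theorem isRightKothe_iff {S : Type u} [Ring S] :
    IsRightKothe.{u, w} S ↔ EveryModuleDecomposes.{u, w} 2 Sᵐᵒᵖ :=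
  isLeftKothe_iff (S := Sᵐᵒᵖ)

theorem isRightArtinian_iff {S : Type u} [Ring S] : IsRightArtinian S ↔ IsArtinianRing Sᵐᵒᵖ :=
  (MulOpposite.opLinearEquiv Sᵐᵒᵖ : S ≃ₗ[Sᵐᵒᵖ] Sᵐᵒᵖ).isArtinian_iff

theorem EveryModuleDecomposes.mono {κ κ' : ℕ∞} (hκ : κ ≤ κ') {S : Type u} [Ring S]
    (h : EveryModuleDecomposes.{u, w} κ S) : EveryModuleDecomposes.{u, w} κ' S := by
  intro M _ _
  obtain ⟨ι, hι, N, hN, hs⟩ := h M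
  exact ⟨ι, hι, N, hN, fun i ↦ (hs i).imp fun s hs ↦ ⟨hs.1.trans_le hκ, hs.2⟩⟩

theorem EveryModuleDecomposes.of_surjective_and_isArtinianRing {κ : ℕ∞} {S : Type u} {T : Type v}
    [Ring S] [Ring T] (h : EveryModuleDecomposes.{u, max v w} κ S) (f : S →+* T)
    (hf : Function.Surjective f) :
    EveryModuleDecomposes.{v, max u w} κ T ∧ IsArtinianRing T := by
  have hT : EveryModuleDecomposes.{v, max u w} κ T :=
    EveryModuleDecomposes.of_surjective.{u, v, w} h f hf
  exact ⟨hT, (hT.mono le_top).isArtinianRing⟩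

theorem EveryModuleDecomposes.op_of_surjective_and_isRightArtinian {κ : ℕ∞} {S : Type u}
    {T : Type v} [Ring S] [Ring T] (h : EveryModuleDecomposes.{u, max v w} κ Sᵐᵒᵖ) (f : S →+* T)
    (hf : Function.Surjective f) :
    EveryModuleDecomposes.{v, max u w} κ Tᵐᵒᵖ ∧ IsRightArtinian T := by
  rw [isRightArtinian_iff]
  exact EveryModuleDecomposes.of_surjective_and_isArtinianRing.{u, v, w} h (RingHom.op f)
    (MulOpposite.op_surjective.comp (hf.comp MulOpposite.unop_surjective))

theorem EveryModuleDecomposes.groupRing {κ : ℕ∞} {R : Type u} [Ring R] [Nontrivial R]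
    {G : Type v} [Group G]
    (h : EveryModuleDecomposes.{max u v, max u v w} κ (MonoidAlgebra R G)) :
    (∀ (I : Ideal R) [I.IsTwoSided], I ≠ ⊤ → ∀ (N : Subgroup G) [N.Normal],
      EveryModuleDecomposes.{max u v, max u v w} κ (MonoidAlgebra (R ⧸ I) (G ⧸ N)) ∧
      IsLeftArtinian (MonoidAlgebra (R ⧸ I) (G ⧸ N))) ∧
    (∀ (I : Ideal R) [I.IsTwoSided], I ≠ ⊤ →
      EveryModuleDecomposes.{u, max u v w} κ (R ⧸ I) ∧ IsLeftArtinian (R ⧸ I)) ∧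
    EveryModuleDecomposes.{u, max u v w} κ R ∧ IsLeftArtinian R ∧
    EveryModuleDecomposes.{max u v, max u v w} κ (MonoidAlgebra R G) ∧
    IsLeftArtinian (MonoidAlgebra R G) ∧ Finite G := by
  have hA : IsArtinianRing (MonoidAlgebra R G) := (h.mono le_top).isArtinianRing
  have hR := EveryModuleDecomposes.of_surjective_and_isArtinianRing.{max u v, u, max u v w} h
    (MonoidAlgebra.augmentation R G) MonoidAlgebra.surjective_augmentation
  refine ⟨fun I _ _ N _ ↦ ?_, fun I _ _ ↦ ?_, hR.1, hR.2, h, hA,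
    MonoidAlgebra.finite_of_isArtinianRing (R := R)⟩
  · exact EveryModuleDecomposes.of_surjective_and_isArtinianRing.{max u v, max u v, max u v w} h _
      (MonoidAlgebra.surjective_mapRingHom_comp_mapDomainRingHom
        (Ideal.Quotient.mk_surjective (I := I)) (QuotientGroup.mk'_surjective N))
  · exact EveryModuleDecomposes.of_surjective_and_isArtinianRing.{max u v, u, max u v w} h
      ((Ideal.Quotient.mk I).comp (MonoidAlgebra.augmentation R G))
      (Ideal.Quotient.mk_surjective.comp MonoidAlgebra.surjective_augmentation)

theorem EveryModuleDecomposes.groupRing_op {κ : ℕ∞} {R : Type u} [Ring R] [Nontrivial R]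
    {G : Type v} [Group G]
    (h : EveryModuleDecomposes.{max u v, max u v w} κ (MonoidAlgebra R G)ᵐᵒᵖ) :
    (∀ (I : Ideal R) [I.IsTwoSided], I ≠ ⊤ → ∀ (N : Subgroup G) [N.Normal],
      EveryModuleDecomposes.{max u v, max u v w} κ (MonoidAlgebra (R ⧸ I) (G ⧸ N))ᵐᵒᵖ ∧
      IsRightArtinian (MonoidAlgebra (R ⧸ I) (G ⧸ N))) ∧
    (∀ (I : Ideal R) [I.IsTwoSided], I ≠ ⊤ →
      EveryModuleDecomposes.{u, max u v w} κ (R ⧸ I)ᵐᵒᵖ ∧ IsRightArtinian (R ⧸ I)) ∧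
    EveryModuleDecomposes.{u, max u v w} κ Rᵐᵒᵖ ∧ IsRightArtinian R ∧
    EveryModuleDecomposes.{max u v, max u v w} κ (MonoidAlgebra R G)ᵐᵒᵖ ∧
    IsRightArtinian (MonoidAlgebra R G) ∧ Finite G := by
  have hA : IsArtinianRing (MonoidAlgebra R G)ᵐᵒᵖ := (h.mono le_top).isArtinianRing
  have hR := EveryModuleDecomposes.op_of_surjective_and_isRightArtinian.{max u v, u, max u v w} h
    (MonoidAlgebra.augmentation R G) MonoidAlgebra.surjective_augmentation
  refine ⟨fun I _ _ N _ ↦ ?_, fun I _ _ ↦ ?_, hR.1, hR.2, h, isRightArtinian_iff.2 hA, ?_⟩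
  · exact EveryModuleDecomposes.op_of_surjective_and_isRightArtinian.{max u v, max u v, max u v w} h
      _ (MonoidAlgebra.surjective_mapRingHom_comp_mapDomainRingHom
        (Ideal.Quotient.mk_surjective (I := I)) (QuotientGroup.mk'_surjective N))
  · exact EveryModuleDecomposes.op_of_surjective_and_isRightArtinian.{max u v, u, max u v w} h
      ((Ideal.Quotient.mk I).comp (MonoidAlgebra.augmentation R G))
      (Ideal.Quotient.mk_surjective.comp MonoidAlgebra.surjective_augmentation)
  -- The opposite of `R[G]` is the group ring of `Gᵐᵒᵖ` over `Rᵐᵒᵖ`.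
  · have : IsArtinianRing (MonoidAlgebra Rᵐᵒᵖ Gᵐᵒᵖ) :=
      (MonoidAlgebra.opRingEquiv (R := R) (M := G)).surjective.isArtinianRing
        (f := (MonoidAlgebra.opRingEquiv (R := R) (M := G)).toRingHom)
    have : Finite Gᵐᵒᵖ := MonoidAlgebra.finite_of_isArtinianRing (R := Rᵐᵒᵖ)
    exact Finite.of_equiv _ MulOpposite.opEquiv.symm

theorem proposition3p4 (R : Type u) [Ring R] [Nontrivial R] (G : Type v) [Group G] :
    (IsLeftPureSemisimple.{max u v, max u v w} (MonoidAlgebra R G) →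
      (∀ (I : Ideal R) [I.IsTwoSided], I ≠ ⊤ → ∀ (N : Subgroup G) [N.Normal],
        IsLeftPureSemisimple.{max u v, max u v w} (MonoidAlgebra (R ⧸ I) (G ⧸ N)) ∧
        IsLeftArtinian (MonoidAlgebra (R ⧸ I) (G ⧸ N))) ∧
      (∀ (I : Ideal R) [I.IsTwoSided], I ≠ ⊤ →
        IsLeftPureSemisimple.{u, max u v w} (R ⧸ I) ∧ IsLeftArtinian (R ⧸ I)) ∧
      IsLeftPureSemisimple.{u, max u v w} R ∧ IsLeftArtinian R ∧
      IsLeftPureSemisimple.{max u v, max u v w} (MonoidAlgebra R G) ∧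
      IsLeftArtinian (MonoidAlgebra R G) ∧
      Finite G) ∧
    (IsRightPureSemisimple.{max u v, max u v w} (MonoidAlgebra R G) →
      (∀ (I : Ideal R) [I.IsTwoSided], I ≠ ⊤ → ∀ (N : Subgroup G) [N.Normal],
        IsRightPureSemisimple.{max u v, max u v w} (MonoidAlgebra (R ⧸ I) (G ⧸ N)) ∧
        IsRightArtinian (MonoidAlgebra (R ⧸ I) (G ⧸ N))) ∧
      (∀ (I : Ideal R) [I.IsTwoSided], I ≠ ⊤ →
        IsRightPureSemisimple.{u, max u v w} (R ⧸ I) ∧ IsRightArtinian (R ⧸ I)) ∧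
      IsRightPureSemisimple.{u, max u v w} R ∧ IsRightArtinian R ∧
      IsRightPureSemisimple.{max u v, max u v w} (MonoidAlgebra R G) ∧
      IsRightArtinian (MonoidAlgebra R G) ∧
      Finite G) ∧
    (IsLeftKothe.{max u v, max u v w} (MonoidAlgebra R G) →
      (∀ (I : Ideal R) [I.IsTwoSided], I ≠ ⊤ → ∀ (N : Subgroup G) [N.Normal],
        IsLeftKothe.{max u v, max u v w} (MonoidAlgebra (R ⧸ I) (G ⧸ N)) ∧
        IsLeftArtinian (MonoidAlgebra (R ⧸ I) (G ⧸ N))) ∧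
      (∀ (I : Ideal R) [I.IsTwoSided], I ≠ ⊤ →
        IsLeftKothe.{u, max u v w} (R ⧸ I) ∧ IsLeftArtinian (R ⧸ I)) ∧
      IsLeftKothe.{u, max u v w} R ∧ IsLeftArtinian R ∧
      IsLeftKothe.{max u v, max u v w} (MonoidAlgebra R G) ∧
      IsLeftArtinian (MonoidAlgebra R G) ∧
      Finite G) ∧
    (IsRightKothe.{max u v, max u v w} (MonoidAlgebra R G) →
      (∀ (I : Ideal R) [I.IsTwoSided], I ≠ ⊤ → ∀ (N : Subgroup G) [N.Normal],
        IsRightKothe.{max u v, max u v w} (MonoidAlgebra (R ⧸ I) (G ⧸ N)) ∧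
        IsRightArtinian (MonoidAlgebra (R ⧸ I) (G ⧸ N))) ∧
      (∀ (I : Ideal R) [I.IsTwoSided], I ≠ ⊤ →
        IsRightKothe.{u, max u v w} (R ⧸ I) ∧ IsRightArtinian (R ⧸ I)) ∧
      IsRightKothe.{u, max u v w} R ∧ IsRightArtinian R ∧
      IsRightKothe.{max u v, max u v w} (MonoidAlgebra R G) ∧
      IsRightArtinian (MonoidAlgebra R G) ∧
      Finite G) := by
  simp_rw [isLeftPureSemisimple_iff, isRightPureSemisimple_iff, isLeftKothe_iff, isRightKothe_iff]
  exact ⟨EveryModuleDecomposes.groupRing.{u, v, w}, EveryModuleDecomposes.groupRing_op.{u, v, w},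
    EveryModuleDecomposes.groupRing.{u, v, w}, EveryModuleDecomposes.groupRing_op.{u, v, w}⟩
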